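/- All systems are finite-dimensional. A state is a positive semidefinite operator of unit trace, $\operatorname{supp}$ denotes the support of an operator, and $[i]=|i\rangle\langle i|$. For a state $\rho_{AB}$ and a system $E\cong B$, let $\mathcal F(\rho_{AB})$ be the set of all marginals $\operatorname{Tr}_B[\omega_{ABE}]$ of states $\omega_{ABE}$ with $\operatorname{Tr}_E[\omega_{ABE}]=\rho_{AB}$ (extensions of $\rho_{AB}$). The state $\rho_{AB}$ is \emph{super two-extendible} if some $\sigma\in\mathcal F(\rho_{AB})$ satisfies $\operatorname{supp}(\sigma)\subseteq\operatorname{supp}(\rho_{AB})$, where $E$ is identified with $B$. A \emph{bipartite private state} of $\log_2 k$ key bits is a state $\gamma^k_{AB}=\frac1k\sum_{i,j=0}^{k-1}|ii\rangle\langle jj|_{A_0B_0}\otimes U_i\,\omega_{A_1B_1}U_j^\dagger$, with $A=A_0A_1$, $B=B_0B_1$, $\omega_{A_1B_1}$ a state and $U_0,\dots,U_{k-1}$ unitaries on $A_1B_1$. Enlarge $B$ by one dimension, spanned by a unit vector $|e\rangle$ orthogonal to the original space, and define the \emph{erased private state} $$\widetilde\eta^{p,k}_{AB}=p\,\gamma^k_{AB}+(1-p)\operatorname{Tr}_B[\gamma^k_{AB}]\otimes[e]_B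 .$$ A \emph{one-way LOCC channel} is a map $\sum_x\mathcal E_x\otimes\mathcal D_x$ (finite sum) with $\mathcal E_x$ completely positive on Alice's side, $\sum_x\mathcal E_x$ trace preserving, and each $\mathcal D_x$ a quantum channel on Bob's side. The \emph{one-shot probabilistic one-way distillable key} $K_D^{(1),\to}(\rho_{AB})$ is the supremum of $q\log_2 k'$ over all $q\in[0,1]$, integers $k'\ge1$, private states $\gamma^{k'}_{A'B'}$ and one-way LOCC channels $\mathcal L$ from $AB$ to $X_AA'B'$ such that $$\mathcal L(\rho_{AB})=q\,[1]_{X_A}\otimes\gamma^{k'}_{A'B'}+(1-q)\,[0]_{X_A}\otimes\frac{I_{A'B'}}{d_{A'}d_{B'}},$$ where $X_A$ is a two-valued flag held by Alice. The \emph{probabilistic one-way distillable secret key} is $K_D^{\to}(\rho_{AB})=\liminf_{n\to\infty}\frac1nK_D^{(1),\to}(\rho_{AB}^{\otimes n})$. Proposition. Let $p\in[0,1)$, let $k\ge2$ be an integer, and let $\gamma^k_{AB}$ be a private state. Then: 1. $\widetilde\eta^{p,k}_{AB}$ is super two-extendible; moreover, it has an extension $\tau_{ABE}$ with $\operatorname{supp}(\operatorname{Tr}_B[\tau_{ABE}])=\operatorname{supp}(\widetilde\eta^{p,k}_{AB})$.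 2. With $E\cong B$, the operator $\omega_{ABE}=p\,\gamma^k_{AB}\otimes[e]_E+(1-p)\,\gamma^k_{AE}\otimes[e]_B$ is a state with $\operatorname{Tr}_E[\omega_{ABE}]=\widetilde\eta^{p,k}_{AB}$ and $\operatorname{Tr}_B[\omega_{ABE}]=\widetilde\eta^{1-p,k}_{AE}$; and if $p\in(0,1)$, then $\operatorname{supp}(\widetilde\eta^{1-p,k})=\operatorname{supp}(\widetilde\eta^{p,k})$. 3. $K_D^{\to}(\widetilde\eta^{p,k}_{AB})=0$. -/

import Mathlib

open scoped ComplexOrder Kronecker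

noncomputable section

namespace QKey

/-! Quantum states, partial traces and supports, in finite dimension.  A system is modelled by
the finite type that indexes an orthonormal basis of its Hilbert space. -/

/-- A quantum state: a positive semidefinite operator of unit trace. -/
def IsState {n : Type*} [Fintype n] (ρ : Matrix n n ℂ) : Prop :=
  ρ.PosSemidef ∧ ρ.trace = 1

/-- The support of a (Hermitian) operator, as a subspace. -/
def supp {n : Type*} [Fintype n] (ρ : Matrix n n ℂ) : Submodule ℂ (n → ℂ) :=
  LinearMap.range ρ.mulVecLin

/-- Partial trace over the last tensor factor. -/
def traceLast {x y : Type*} [Fintype y] (M : Matrix (x × y) (x × y) ℂ) : Matrix x x ℂ :=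
  fun i i' => ∑ j, M (i, j) (i', j)

/-- Exchange of the systems `B` and `E` in an operator on `ABE`. -/
def swapBE {a b : Type*} (M : Matrix ((a × b) × b) ((a × b) × b) ℂ) :
    Matrix ((a × b) × b) ((a × b) × b) ℂ :=
  M.submatrix (fun x => ((x.1.1, x.2), x.1.2)) (fun x => ((x.1.1, x.2), x.1.2))

/-- Partial trace over `B` of an operator on `ABE`; the result is an operator on `AE`. -/
def traceMid {a b : Type*} [Fintype b] (M : Matrix ((a × b) × b) ((a × b) × b) ℂ) :
    Matrix (a × b) (a × b) ℂ :=
  fun x y => ∑ j, M ((x.1, j), x.2) ((y.1, j), y.2)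

/-- `ω` is a state of `ABE` (with `E` isomorphic to `B`) that extends `ρ`. -/
def IsExtension {a b : Type*} [Fintype a] [Fintype b]
    (ω : Matrix ((a × b) × b) ((a × b) × b) ℂ) (ρ : Matrix (a × b) (a × b) ℂ) : Prop :=
  IsState ω ∧ traceLast ω = ρ

/-- The set of the marginals on `AE` of the extensions of `ρ`. -/
def extensionMarginals {a b : Type*} [Fintype a] [Fintype b] (ρ : Matrix (a × b) (a × b) ℂ) :
    Set (Matrix (a × b) (a × b) ℂ) :=
  {σ | ∃ ω, IsExtension ω ρ ∧ traceMid ω = σ}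

/-- The set of super two-extendible states of a bipartite system. -/
def superTwoExt (a b : Type*) [Fintype a] [Fintype b] : Set (Matrix (a × b) (a × b) ℂ) :=
  {ρ | IsState ρ ∧ ∃ σ ∈ extensionMarginals ρ, supp σ ≤ supp ρ}

/-! Channels. -/

/-- The map `Φ ⊗ id` on the operators of a bipartite system. -/
def mapLeft {a a' b : Type*} (Φ : Matrix a a ℂ →ₗ[ℂ] Matrix a' a' ℂ) :
    Matrix (a × b) (a × b) ℂ →ₗ[ℂ] Matrix (a' × b) (a' × b) ℂ where
  toFun M := fun x y => Φ (fun i i' => M (i, x.2) (i', y.2)) x.1 y.1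
  map_add' M N := by
    ext x y
    exact congrFun (congrFun (Φ.map_add (fun i i' => M (i, x.2) (i', y.2))
      (fun i i' => N (i, x.2) (i', y.2))) x.1) y.1
  map_smul' c M := by
    ext x y
    exact congrFun (congrFun (Φ.map_smul c (fun i i' => M (i, x.2) (i', y.2))) x.1) y.1

/-- The map `id ⊗ Φ` on the operators of a bipartite system. -/
def mapRight {a b b' : Type*} (Φ : Matrix b b ℂ →ₗ[ℂ] Matrix b' b' ℂ) :
    Matrix (a × b) (a × b) ℂ →ₗ[ℂ] Matrix (a × b') (a × b') ℂ where
  toFun M := fun x y => Φ (fun j j' => M (x.1, j) (y.1, j')) x.2 y.2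
  map_add' M N := by
    ext x y
    exact congrFun (congrFun (Φ.map_add (fun j j' => M (x.1, j) (y.1, j'))
      (fun j j' => N (x.1, j) (y.1, j'))) x.2) y.2
  map_smul' c M := by
    ext x y
    exact congrFun (congrFun (Φ.map_smul c (fun j j' => M (x.1, j) (y.1, j'))) x.2) y.2

/-- Complete positivity: `id ⊗ Φ` is positive for an ancilla of every finite dimension. -/
def IsCP {a a' : Type*} [Fintype a] [Fintype a']
    (Φ : Matrix a a ℂ →ₗ[ℂ] Matrix a' a' ℂ) : Prop :=
  ∀ (n : ℕ) (X : Matrix (Fin n × a) (Fin n × a) ℂ), X.PosSemidef → (mapRight Φ X).PosSemidef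

/-- Trace preservation. -/
def IsTP {a a' : Type*} [Fintype a] [Fintype a']
    (Φ : Matrix a a ℂ →ₗ[ℂ] Matrix a' a' ℂ) : Prop :=
  ∀ X : Matrix a a ℂ, (Φ X).trace = X.trace

/-- One-way LOCC channels (communication from Alice to Bob): Alice applies an instrument
`(E x)` and sends the classical outcome `x` to Bob, who applies a channel `D x`. -/
def IsOneWayLOCC {a b a' b' : Type*} [Fintype a] [Fintype b] [Fintype a'] [Fintype b']
    (L : Matrix (a × b) (a × b) ℂ →ₗ[ℂ] Matrix (a' × b') (a' × b') ℂ) : Prop :=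
  ∃ (r : ℕ) (E : Fin r → (Matrix a a ℂ →ₗ[ℂ] Matrix a' a' ℂ))
    (D : Fin r → (Matrix b b ℂ →ₗ[ℂ] Matrix b' b' ℂ)),
    (∀ x, IsCP (E x)) ∧ IsTP (∑ x, E x) ∧ (∀ x, IsCP (D x) ∧ IsTP (D x)) ∧
      L = ∑ x, mapRight (D x) ∘ₗ mapLeft (E x)

/-! Private states and distillable key. -/

/-- The bipartite private state
`(1/k) ∑ i j, |i i⟩⟨j j| ⊗ U i * ω * (U j)ᴴ` with key systems of dimension `k` and shield
systems `a`, `b`; Alice holds `Fin k × a` and Bob holds `Fin k × b`. -/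
def privateState {a b : Type*} [Fintype a] [Fintype b] [DecidableEq a] [DecidableEq b] (k : ℕ)
    (ω : Matrix (a × b) (a × b) ℂ) (U : Fin k → Matrix.unitaryGroup (a × b) ℂ) :
    Matrix ((Fin k × a) × (Fin k × b)) ((Fin k × a) × (Fin k × b)) ℂ :=
  fun x y =>
    if x.1.1 = x.2.1 ∧ y.1.1 = y.2.1 then
      (1 / (k : ℂ)) *
        ((U x.1.1).1 * ω * (U y.1.1).1.conjTranspose) (x.1.2, x.2.2) (y.1.2, y.2.2)
    else 0

/-- The operator `[i] ⊗ M` on `XAB`, the flag `X` being held together with `A`. -/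
def flagged {a b : Type*} (i : Fin 2) (M : Matrix (a × b) (a × b) ℂ) :
    Matrix ((Fin 2 × a) × b) ((Fin 2 × a) × b) ℂ :=
  (Matrix.single i i (1 : ℂ) ⊗ₖ M).submatrix (Equiv.prodAssoc _ _ _) (Equiv.prodAssoc _ _ _)

/-- The maximally mixed state of a bipartite system. -/
def maxMixed (a b : Type*) [Fintype a] [Fintype b] [DecidableEq a] [DecidableEq b] :
    Matrix (a × b) (a × b) ℂ :=
  (1 / ((Fintype.card a : ℂ) * (Fintype.card b : ℂ))) • 1

/-- With probability `p`, some one-way LOCC channel distills from `ρ` a private state of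
`log₂ k` secret key bits, success being recorded in a flag that Alice holds. -/
def Distills {a b : Type*} [Fintype a] [Fintype b] (ρ : Matrix (a × b) (a × b) ℂ)
    (p : ℝ) (k : ℕ) : Prop :=
  ∃ (m n : ℕ) (ω : Matrix (Fin m × Fin n) (Fin m × Fin n) ℂ)
    (U : Fin k → Matrix.unitaryGroup (Fin m × Fin n) ℂ)
    (L : Matrix (a × b) (a × b) ℂ →ₗ[ℂ]
      Matrix ((Fin 2 × (Fin k × Fin m)) × (Fin k × Fin n))
        ((Fin 2 × (Fin k × Fin m)) × (Fin k × Fin n)) ℂ),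
    IsState ω ∧ IsOneWayLOCC L ∧
      L ρ = (p : ℂ) • flagged 1 (privateState k ω U) +
        ((1 - p : ℝ) : ℂ) • flagged 0 (maxMixed (Fin k × Fin m) (Fin k × Fin n))

/-- The one-shot probabilistic one-way distillable secret key (a supremum of reals, which
is taken in the extended reals). -/
def oneShotKey {a b : Type*} [Fintype a] [Fintype b] (ρ : Matrix (a × b) (a × b) ℂ) : EReal :=
  sSup {v | ∃ (p : ℝ) (k : ℕ), 0 ≤ p ∧ p ≤ 1 ∧ 1 ≤ k ∧ Distills ρ p k ∧
    v = ((p * Real.logb 2 k : ℝ) : EReal)}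

/-- The `n`-fold tensor power of a bipartite operator, as an operator on `AⁿBⁿ`. -/
def tensorPower {a b : Type*} (ρ : Matrix (a × b) (a × b) ℂ) (n : ℕ) :
    Matrix ((Fin n → a) × (Fin n → b)) ((Fin n → a) × (Fin n → b)) ℂ :=
  fun x y => ∏ t, ρ (x.1 t, x.2 t) (y.1 t, y.2 t)

/-- The probabilistic one-way distillable secret key. -/
def distillableKey {a b : Type*} [Fintype a] [Fintype b]
    (ρ : Matrix (a × b) (a × b) ℂ) : EReal :=
  Filter.liminf (fun n : ℕ => oneShotKey (tensorPower ρ n) / (n : EReal)) Filter.atTop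

/-! Erasure.  The system `B` is enlarged by one dimension, spanned by the erasure symbol, which
is the basis vector `none` of `Option b`. -/

/-- The pure state `[e]` of the erasure symbol. -/
def erasure (b : Type*) [DecidableEq b] : Matrix (Option b) (Option b) ℂ :=
  Matrix.single none none 1

/-- An operator on `AB`, viewed on `A` and the enlarged system `B`. -/
def embed {a b : Type*} (γ : Matrix (a × b) (a × b) ℂ) :
    Matrix (a × Option b) (a × Option b) ℂ :=
  fun x y =>
    match x.2, y.2 with
    | some j, some j' => γ (x.1, j) (y.1, j')
    | _, _ => 0

/-- The state `p γ + (1 - p) Tr_B[γ] ⊗ [e]`: Bob's share of `γ` is erased with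
probability `1 - p`. -/
def erased {a b : Type*} [Fintype b] [DecidableEq b] (p : ℝ) (γ : Matrix (a × b) (a × b) ℂ) :
    Matrix (a × Option b) (a × Option b) ℂ :=
  (p : ℂ) • embed γ + ((1 - p : ℝ) : ℂ) • (traceLast γ ⊗ₖ erasure b)

/-- The operator `p γ_AB ⊗ [e]_E + (1 - p) γ_AE ⊗ [e]_B` on `ABE`. -/
def erasedExtension {a b : Type*} [DecidableEq b] (p : ℝ) (γ : Matrix (a × b) (a × b) ℂ) :
    Matrix ((a × Option b) × Option b) ((a × Option b) × Option b) ℂ :=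
  (p : ℂ) • (embed γ ⊗ₖ erasure b) + ((1 - p : ℝ) : ℂ) • swapBE (embed γ ⊗ₖ erasure b)

end QKey

end

namespace QKey

open Matrix

/-! Completely positive maps on one tensor factor. -/

/-! Parts 1 and 2 are computations with `erasedExtension`. Its two marginals are `erased p γ` and
`erased (1 - p) γ`, which are block diagonal with the same two blocks (not erased, erased) and
differ only in the weights. For `0 < p < 1` both weights are nonzero, so the supports agree; for `p
= 0` a product extension is used instead.

Part 3 replaces support inclusion by the operator inequality `Tr_B τ ≤ c ρ`
(`HasDominatedExtension`), which is equivalent for positive semidefinite operators in finite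
dimension and easier to transport. It survives tensor powers (`HasDominatedExtension.tensorPower`),
by telescoping, and one-way LOCC (`HasDominatedExtension.map`), because the message that Alice sends
to Bob can also be sent to `E`, where Bob's channel is repeated.

It remains to see that `q [1] ⊗ γ + r [0] ⊗ M`, with `γ` private and `k ≥ 2`, has a dominated
extension only if `q = 0` (`HasDominatedExtension.eq_zero`). Domination makes the key value held by
`E` equal to Alice's whenever the flag is 1. Privacy makes Alice's key uniform given any outcome on
`E`, since partial isometries on `AB` exchange the key values on `γ`. Both can hold only if success
has probability zero. So every admissible rate is zero, either because `q = 0` or because `log₂ 1 =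
0`. -/

theorem IsCP.mapRight_posSemidef {a a' n : Type*} [Fintype a] [Fintype a'] [Finite n]
    {Φ : Matrix a a ℂ →ₗ[ℂ] Matrix a' a' ℂ} (hΦ : IsCP Φ) {X : Matrix (n × a) (n × a) ℂ}
    (hX : X.PosSemidef) : (mapRight Φ X).PosSemidef := by
  -- `IsCP` only tests ancillas of the form `Fin N`; any other finite ancilla is reindexed to one.
  obtain ⟨N, ⟨e⟩⟩ := Finite.exists_equiv_fin n
  have h := hΦ N (X.submatrix (fun x => (e.symm x.1, x.2)) (fun x => (e.symm x.1, x.2)))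
    (hX.submatrix _)
  have h2 := h.submatrix (fun x : n × a' => (e x.1, x.2))
  have h3 : mapRight Φ X = (mapRight Φ (X.submatrix (fun x => (e.symm x.1, x.2))
      (fun x => (e.symm x.1, x.2)))).submatrix (fun x : n × a' => (e x.1, x.2))
      (fun x => (e x.1, x.2)) := by
    ext x y
    change Φ (fun j j' => X (x.1, j) (y.1, j')) x.2 y.2 =
      Φ (fun j j' => X (e.symm (e x.1), j) (e.symm (e y.1), j')) x.2 y.2
    simp only [Equiv.symm_apply_apply]
  rwa [h3]

theorem IsCP.mapLeft_posSemidef {a a' n : Type*} [Fintype a] [Fintype a'] [Finite n]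
    {Φ : Matrix a a ℂ →ₗ[ℂ] Matrix a' a' ℂ} (hΦ : IsCP Φ) {X : Matrix (a × n) (a × n) ℂ}
    (hX : X.PosSemidef) : (mapLeft Φ X).PosSemidef :=
  (hΦ.mapRight_posSemidef (hX.submatrix (Prod.swap : n × a → a × n))).submatrix Prod.swap

/-- The idle factor `a` is absorbed into the ancilla. -/
theorem IsCP.mapRight {a b b' : Type*} [Fintype a] [Fintype b] [Fintype b']
    {Φ : Matrix b b ℂ →ₗ[ℂ] Matrix b' b' ℂ} (hΦ : IsCP Φ) :
    IsCP (mapRight Φ : Matrix (a × b) (a × b) ℂ →ₗ[ℂ] _) := fun n _ hX =>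
  (hΦ.mapRight_posSemidef (hX.submatrix (Equiv.prodAssoc (Fin n) a b))).submatrix
    (Equiv.prodAssoc (Fin n) a b').symm

theorem IsCP.mapLeft {a a' b : Type*} [Fintype a] [Fintype a'] [Fintype b]
    {Φ : Matrix a a ℂ →ₗ[ℂ] Matrix a' a' ℂ} (hΦ : IsCP Φ) :
    IsCP (mapLeft Φ : Matrix (a × b) (a × b) ℂ →ₗ[ℂ] _) := fun n _ hX =>
  (hΦ.mapRight_posSemidef (hX.submatrix
    (fun x : (Fin n × b) × a => (x.1.1, (x.2, x.1.2))))).submatrix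
    (fun x : Fin n × (a' × b) => ((x.1, x.2.2), x.2.1))

theorem IsCP.comp {a b c : Type*} [Fintype a] [Fintype b] [Fintype c]
    {Φ : Matrix a a ℂ →ₗ[ℂ] Matrix b b ℂ} {Ψ : Matrix b b ℂ →ₗ[ℂ] Matrix c c ℂ}
    (hΨ : IsCP Ψ) (hΦ : IsCP Φ) : IsCP (Ψ ∘ₗ Φ) := fun n X hX => hΨ n _ (hΦ n X hX)

/-! Partial traces. -/

theorem traceLast_eq_sum {x y : Type*} [Fintype y] (M : Matrix (x × y) (x × y) ℂ) :
    traceLast M = ∑ j, M.submatrix (fun i => (i, j)) (fun i => (i, j)) := by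
  ext i i'
  simp [traceLast, Matrix.sum_apply]

theorem traceLast_posSemidef {x y : Type*} [Fintype y] {M : Matrix (x × y) (x × y) ℂ}
    (hM : M.PosSemidef) : (traceLast M).PosSemidef := by
  rw [traceLast_eq_sum]
  exact posSemidef_sum _ fun j _ => hM.submatrix _

theorem traceMid_posSemidef {a b : Type*} [Fintype b] {M : Matrix ((a × b) × b) ((a × b) × b) ℂ}
    (hM : M.PosSemidef) : (traceMid M).PosSemidef :=
  traceLast_posSemidef (hM.submatrix fun x : (a × b) × b => ((x.1.1, x.2), x.1.2))

theorem trace_traceLast {x y : Type*} [Fintype x] [Fintype y] (M : Matrix (x × y) (x × y) ℂ) :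
    (traceLast M).trace = M.trace := by
  simp [traceLast, Matrix.trace, Fintype.sum_prod_type]

theorem traceLast_sum {x y ι : Type*} [Fintype y] (s : Finset ι)
    (M : ι → Matrix (x × y) (x × y) ℂ) :
    traceLast (∑ i ∈ s, M i) = ∑ i ∈ s, traceLast (M i) := by
  ext i i'
  simp only [traceLast, Matrix.sum_apply]
  exact Finset.sum_comm

theorem traceMid_sum {a b ι : Type*} [Fintype b] (s : Finset ι)
    (M : ι → Matrix ((a × b) × b) ((a × b) × b) ℂ) :
    traceMid (∑ i ∈ s, M i) = ∑ i ∈ s, traceMid (M i) := by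
  ext i i'
  simp only [traceMid, Matrix.sum_apply]
  exact Finset.sum_comm

theorem traceLast_mapRight {x y y' : Type*} [Fintype y] [Fintype y']
    {Φ : Matrix y y ℂ →ₗ[ℂ] Matrix y' y' ℂ} (hΦ : IsTP Φ) (M : Matrix (x × y) (x × y) ℂ) :
    traceLast (mapRight Φ M) = traceLast M := by
  ext i i'
  exact hΦ fun j j' => M (i, j) (i', j')

theorem map_apply_eq_sum {a a' ι : Type*} [Fintype ι] (Φ : Matrix a a ℂ →ₗ[ℂ] Matrix a' a' ℂ)
    (N : ι → Matrix a a ℂ) (x y : a') :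
    Φ (fun i i' => ∑ j, N j i i') x y = ∑ j, Φ (N j) x y := by
  have : (fun i i' => ∑ j, N j i i' : Matrix a a ℂ) = ∑ j, N j := by
    ext i i'
    simp [Matrix.sum_apply]
  rw [this, map_sum, Matrix.sum_apply]

theorem traceLast_mapLeft {x x' y : Type*} [Fintype y]
    (Φ : Matrix x x ℂ →ₗ[ℂ] Matrix x' x' ℂ) (M : Matrix (x × y) (x × y) ℂ) :
    traceLast (mapLeft Φ M) = Φ (traceLast M) := by
  ext i i'
  exact (map_apply_eq_sum Φ (fun j i i' => M (i, j) (i', j)) i i').symm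

/-- With `D` acting on both `B` and `E`, the copy on `B` disappears under the trace over `B`. What
remains on `AE` is the branch of the LOCC map that originally acted on `AB`. -/
theorem traceMid_mapRight_mapLeft {a a' b b' : Type*} [Fintype b] [Fintype b']
    (E : Matrix a a ℂ →ₗ[ℂ] Matrix a' a' ℂ) {D : Matrix b b ℂ →ₗ[ℂ] Matrix b' b' ℂ}
    (hD : IsTP D) (τ : Matrix ((a × b) × b) ((a × b) × b) ℂ) :
    traceMid (mapRight D (mapLeft (mapRight D ∘ₗ mapLeft E) τ)) =
      mapRight D (mapLeft E (traceMid τ)) := by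
  have key (e e' : b) (i i' : a') :
      ∑ j, mapLeft (mapRight D ∘ₗ mapLeft E) τ ((i, j), e) ((i', j), e') =
        mapLeft E (traceMid τ) (i, e) (i', e') := by
    have h := traceLast_mapRight hD (mapLeft E (τ.submatrix (fun z => (z, e)) (fun z => (z, e'))))
    rw [traceLast_mapLeft] at h
    exact congrFun (congrFun h i) i'
  ext x y
  refine (map_apply_eq_sum D (fun j e e' =>
    mapLeft (mapRight D ∘ₗ mapLeft E) τ ((x.1, j), e) ((y.1, j), e')) x.2 y.2).symm.trans ?_
  simp only [key]
  rfl

/-! Extensions whose other marginal is dominated by the extended state. -/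

/-- `ρ` has an extension to `ABE` whose marginal on `AE` is at most a multiple of `ρ`. -/
def HasDominatedExtension {a b : Type*} [Fintype a] [Fintype b]
    (ρ : Matrix (a × b) (a × b) ℂ) : Prop :=
  ∃ (τ : Matrix ((a × b) × b) ((a × b) × b) ℂ) (c : ℂ),
    τ.PosSemidef ∧ traceLast τ = ρ ∧ (c • ρ - traceMid τ).PosSemidef

theorem IsOneWayLOCC.posSemidef {a b a' b' : Type*} [Fintype a] [Fintype b] [Fintype a']
    [Fintype b'] {L : Matrix (a × b) (a × b) ℂ →ₗ[ℂ] Matrix (a' × b') (a' × b') ℂ}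
    (hL : IsOneWayLOCC L) {X : Matrix (a × b) (a × b) ℂ} (hX : X.PosSemidef) :
    (L X).PosSemidef := by
  obtain ⟨r, E, D, hE, -, hD, rfl⟩ := hL
  rw [LinearMap.sum_apply]
  exact posSemidef_sum _ fun x _ => (hD x).1.mapRight_posSemidef ((hE x).mapLeft_posSemidef hX)

theorem HasDominatedExtension.map {a b a' b' : Type*} [Fintype a] [Fintype b] [Fintype a']
    [Fintype b'] {L : Matrix (a × b) (a × b) ℂ →ₗ[ℂ] Matrix (a' × b') (a' × b') ℂ}
    (hL : IsOneWayLOCC L) {ρ : Matrix (a × b) (a × b) ℂ} (hρ : HasDominatedExtension ρ) :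
    HasDominatedExtension (L ρ) := by
  obtain ⟨τ, c, hτ, rfl, hc⟩ := hρ
  have hc' := hL.posSemidef hc
  obtain ⟨r, E, D, hE, -, hD, rfl⟩ := hL
  -- In branch `x`, the inner maps act as `E x` on `A` and `D x` on `B`, and the outer map acts as
  -- `D x` on `E`. The constant `c` is unchanged because `L` is linear and positive.
  refine ⟨∑ x, mapRight (D x) (mapLeft (mapRight (D x) ∘ₗ mapLeft (E x)) τ), c, ?_, ?_, ?_⟩
  · exact posSemidef_sum _ fun x _ => (hD x).1.mapRight_posSemidef
      (((hD x).1.mapRight.comp (hE x).mapLeft).mapLeft_posSemidef hτ)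
  · simp only [traceLast_sum, LinearMap.sum_apply]
    exact Finset.sum_congr rfl fun x _ => by
      rw [traceLast_mapRight (hD x).2, traceLast_mapLeft]
  · have h : traceMid (∑ x, mapRight (D x) (mapLeft (mapRight (D x) ∘ₗ mapLeft (E x)) τ)) =
        (∑ x, mapRight (D x) ∘ₗ mapLeft (E x)) (traceMid τ) := by
      rw [traceMid_sum, LinearMap.sum_apply]
      exact Finset.sum_congr rfl fun x _ => traceMid_mapRight_mapLeft _ (hD x).2 _
    rw [h]
    rwa [map_sub, map_smul] at hc'

/-! Tensor powers. -/

/-- The Schur product theorem. A tensor power is an entrywise product of pullbacks of its factors,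
so Hadamard products replace iterated Kronecker products. -/
theorem posSemidef_prod {ι n : Type*} [Finite n] (s : Finset ι) {Z : ι → Matrix n n ℂ}
    (hZ : ∀ t ∈ s, (Z t).PosSemidef) :
    (Matrix.of fun x y => ∏ t ∈ s, Z t x y).PosSemidef := by
  classical
  have := Fintype.ofFinite n
  induction s using Finset.induction_on with
  | empty =>
    convert posSemidef_vecMulVec_self_star (fun _ : n => (1 : ℂ)) using 1
    ext
    simp [vecMulVec_apply]
  | insert t s ht ih =>
    have h := (hZ t (by simp)).hadamard (ih fun u hu => hZ u (by simp [hu]))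
    simp only [Finset.prod_insert ht]
    exact h

/-- Telescoping: `Z Z' - Y Y' = (Z - Y) Z' + Y (Z' - Y')`, where each product on the right is
positive semidefinite. -/
theorem posSemidef_prod_sub_prod {ι n : Type*} [Finite n] (s : Finset ι)
    {Y Z : ι → Matrix n n ℂ} (hY : ∀ t ∈ s, (Y t).PosSemidef)
    (hYZ : ∀ t ∈ s, (Z t - Y t).PosSemidef) :
    (Matrix.of fun x y => ∏ t ∈ s, Z t x y - ∏ t ∈ s, Y t x y).PosSemidef := by
  classical
  have := Fintype.ofFinite n
  induction s using Finset.induction_on with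
  | empty =>
    convert Matrix.PosSemidef.zero using 1
    ext
    simp
  | insert t s ht ih =>
    have hZ : ∀ u ∈ insert t s, (Z u).PosSemidef := fun u hu => by
      simpa using (hYZ u hu).add (hY u hu)
    have h1 := (hYZ t (by simp)).hadamard (posSemidef_prod s fun u hu => hZ u (by simp [hu]))
    have h2 := (hY t (by simp)).hadamard (ih (fun u hu => hY u (by simp [hu]))
      fun u hu => hYZ u (by simp [hu]))
    have h : (Matrix.of fun x y => ∏ u ∈ insert t s, Z u x y - ∏ u ∈ insert t s, Y u x y) =
        ((Z t - Y t) ⊙ Matrix.of fun x y => ∏ u ∈ s, Z u x y) +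
          Y t ⊙ Matrix.of fun x y => ∏ u ∈ s, Z u x y - ∏ u ∈ s, Y u x y := by
      ext x y
      simp only [Finset.prod_insert ht, Matrix.of_apply, Matrix.add_apply,
        Matrix.hadamard_apply, Matrix.sub_apply]
      ring
    rw [h]
    exact h1.add h2

theorem HasDominatedExtension.tensorPower {a b : Type*} [Fintype a] [Fintype b]
    {ρ : Matrix (a × b) (a × b) ℂ} (hρ : HasDominatedExtension ρ) (n : ℕ) :
    HasDominatedExtension (tensorPower ρ n) := by
  classical
  obtain ⟨τ, c, hτ, rfl, hc⟩ := hρ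
  refine ⟨fun x y => ∏ t, τ ((x.1.1 t, x.1.2 t), x.2 t) ((y.1.1 t, y.1.2 t), y.2 t), c ^ n,
    ?_, ?_, ?_⟩
  · exact posSemidef_prod Finset.univ fun t _ => hτ.submatrix
      fun x : ((Fin n → a) × (Fin n → b)) × (Fin n → b) => ((x.1.1 t, x.1.2 t), x.2 t)
  · ext x y
    simp only [traceLast, QKey.tensorPower]
    rw [Fintype.prod_sum]
  · have h := posSemidef_prod_sub_prod Finset.univ
      (Y := fun t => (traceMid τ).submatrix
        (fun x : (Fin n → a) × (Fin n → b) => (x.1 t, x.2 t)) fun x => (x.1 t, x.2 t))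
      (Z := fun t => (c • traceLast τ).submatrix
        (fun x : (Fin n → a) × (Fin n → b) => (x.1 t, x.2 t)) fun x => (x.1 t, x.2 t))
      (fun t _ => (traceMid_posSemidef hτ).submatrix _) (fun t _ => hc.submatrix _)
    convert h using 1
    ext x y
    simp only [Matrix.sub_apply, Matrix.smul_apply, Matrix.of_apply, Matrix.submatrix_apply,
      smul_eq_mul, Finset.prod_mul_distrib, Finset.prod_const, Finset.card_univ,
      Fintype.card_fin, QKey.tensorPower]
    congr 1
    simp only [traceMid]
    rw [Fintype.prod_sum]

theorem trace_tensorPower {a b : Type*} [Fintype a] [Fintype b] (ρ : Matrix (a × b) (a × b) ℂ)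
    (n : ℕ) : (tensorPower ρ n).trace = ρ.trace ^ n := by
  classical
  have h : ρ.trace ^ n = ∏ _t : Fin n, ∑ x, ρ x x := by simp [Matrix.trace]
  rw [h, Fintype.prod_sum]
  exact Fintype.sum_equiv (Equiv.arrowProdEquivProdArrow _ _ _).symm _ _ fun x => rfl

/-! Operators below a state share its kernel. -/

/-- `0 ≤ M S Mᴴ ≤ M R Mᴴ = 0`, and a positive semidefinite `S` annihilates every vector on which its
quadratic form vanishes. -/
theorem mul_eq_zero_of_posSemidef_sub {m n : Type*} [Fintype m] [Fintype n]
    {R S : Matrix n n ℂ} (hS : S.PosSemidef) (hRS : (R - S).PosSemidef) {M : Matrix m n ℂ}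
    (hM : M * R = 0) : M * S = 0 := by
  have h1 := hS.mul_mul_conjTranspose_same M
  have h2 := hRS.mul_mul_conjTranspose_same M
  rw [Matrix.mul_sub, hM, zero_sub, Matrix.neg_mul] at h2
  have key : S * Mᴴ = 0 := by
    ext x i
    have h3 : (M * S * Mᴴ) i i = 0 :=
      le_antisymm (by simpa using h2.diag_nonneg (i := i)) h1.diag_nonneg
    have h4 : star (star (M i)) ⬝ᵥ (S *ᵥ star (M i)) = 0 := by
      rw [← h3, Matrix.mul_assoc, star_star]
      rfl
    exact congrFun ((hS.dotProduct_mulVec_zero_iff _).1 h4) x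
  have := congrArg conjTranspose key
  rwa [conjTranspose_mul, conjTranspose_conjTranspose, hS.isHermitian.eq,
    conjTranspose_zero] at this

/-- If the tests `Q` and `Q'` are carried into each other on `R` by a partial isometry, then
they have equal probabilities on all operators below `R`. -/
theorem trace_mul_eq_of_posSemidef_sub {n : Type*} [Fintype n] {R S Q Q' T T' : Matrix n n ℂ}
    (hS : S.PosSemidef) (hRS : (R - S).PosSemidef) (hQ : Qᴴ * Q = Q) (hT : Tᴴ * T = T')
    (hQT : Q * R = T * R) (hQT' : Q' * R = T' * R) : (Q * S).trace = (Q' * S).trace := by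
  have h1 : Q * S = T * S := by
    rw [← sub_eq_zero, ← Matrix.sub_mul]
    exact mul_eq_zero_of_posSemidef_sub hS hRS (by rw [Matrix.sub_mul, hQT, sub_self])
  have h2 : Q' * S = T' * S := by
    rw [← sub_eq_zero, ← Matrix.sub_mul]
    exact mul_eq_zero_of_posSemidef_sub hS hRS (by rw [Matrix.sub_mul, hQT', sub_self])
  have h3 : S * Qᴴ = S * Tᴴ := by
    simpa [conjTranspose_mul, hS.isHermitian.eq] using congrArg conjTranspose h1
  -- `Q` can be exchanged for `T` only next to `S`; `hQ` and cyclicity supply one factor on each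
  -- side of `S`.
  calc (Q * S).trace = (Q * (S * Qᴴ)).trace := by
        rw [← Matrix.mul_assoc, Matrix.trace_mul_comm (Q * S), ← Matrix.mul_assoc, hQ]
    _ = (T * S * Tᴴ).trace := by
        rw [h3, ← Matrix.mul_assoc, h1]
    _ = (Q' * S).trace := by
        rw [Matrix.trace_mul_comm, ← Matrix.mul_assoc, hT, h2]

/-! Private states. -/

section PrivateState

variable {a b : Type*} [DecidableEq a] [DecidableEq b] [Fintype a] [Fintype b] {k : ℕ}

/-- The controlled embedding `∑ i, |i i⟩ ⊗ U i` of the shield into key and shield. -/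
def twist (U : Fin k → Matrix.unitaryGroup (a × b) ℂ) :
    Matrix ((Fin k × a) × (Fin k × b)) (a × b) ℂ :=
  fun x s => if x.1.1 = x.2.1 then (U x.1.1).1 (x.1.2, x.2.2) s else 0

/-- The isometry `|i i⟩ ⊗ U i`. -/
def keyIsometry (U : Fin k → Matrix.unitaryGroup (a × b) ℂ) (i : Fin k) :
    Matrix ((Fin k × a) × (Fin k × b)) (a × b) ℂ :=
  fun x s => if x.1.1 = i ∧ x.2.1 = i then (U i).1 (x.1.2, x.2.2) s else 0

/-- The projection onto the value `i` of Alice's key system. -/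
def keyProj (a b : Type*) [DecidableEq a] [DecidableEq b] (i : Fin k) :
    Matrix ((Fin k × a) × (Fin k × b)) ((Fin k × a) × (Fin k × b)) ℂ :=
  diagonal fun x => if x.1.1 = i then 1 else 0

theorem privateState_eq (ω : Matrix (a × b) (a × b) ℂ)
    (U : Fin k → Matrix.unitaryGroup (a × b) ℂ) :
    privateState k ω U = (1 / (k : ℂ)) • (twist U * ω * (twist U)ᴴ) := by
  ext x y
  by_cases hx : x.1.1 = x.2.1 <;> by_cases hy : y.1.1 = y.2.1 <;>
    simp [privateState, twist, Matrix.mul_apply, hx, hy]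

theorem keyProj_mul_twist (U : Fin k → Matrix.unitaryGroup (a × b) ℂ) (i : Fin k) :
    keyProj a b i * twist U = keyIsometry U i := by
  ext x s
  simp only [keyProj, twist, keyIsometry, diagonal_mul]
  by_cases h : x.1.1 = i
  · subst h
    simp [eq_comm]
  · simp [h]

theorem conjTranspose_keyProj_mul_self (i : Fin k) :
    (keyProj a b i)ᴴ * keyProj a b i = keyProj a b i := by
  rw [keyProj, diagonal_conjTranspose, diagonal_mul_diagonal]
  congr 1
  ext x
  by_cases h : x.1.1 = i <;> simp [h]

/-- Blocks with different key values are orthogonal, so only the unitary block `U i` contributes. -/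
theorem conjTranspose_keyIsometry_mul_twist (U : Fin k → Matrix.unitaryGroup (a × b) ℂ)
    (i : Fin k) : (keyIsometry U i)ᴴ * twist U = 1 := by
  have h : star (U i).1 * (U i).1 = 1 := Matrix.UnitaryGroup.star_mul_self (U i)
  rw [← h]
  ext s t
  have h2 (x : (Fin k × a) × (Fin k × b)) : (keyIsometry U i)ᴴ s x * twist U x t =
      if x.1.1 = i then if x.2.1 = i then
        star ((U i).1 (x.1.2, x.2.2) s) * (U i).1 (x.1.2, x.2.2) t else 0 else 0 := by
    simp only [conjTranspose_apply, keyIsometry, twist]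
    by_cases h1 : x.1.1 = i
    · by_cases h2 : x.2.1 = i <;> simp [h1, h2]
    · simp [h1]
  simp only [Matrix.mul_apply, h2, Fintype.sum_prod_type, star_apply]
  simp

theorem conjTranspose_keyIsometry_mul_self (U : Fin k → Matrix.unitaryGroup (a × b) ℂ)
    (i : Fin k) : (keyIsometry U i)ᴴ * keyIsometry U i = 1 := by
  rw [← conjTranspose_keyIsometry_mul_twist U i]
  ext s t
  simp only [Matrix.mul_apply, conjTranspose_apply, keyIsometry, twist]
  refine Finset.sum_congr rfl fun x _ => ?_
  by_cases h1 : x.1.1 = i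
  · by_cases h2 : x.2.1 = i <;> simp [h1, h2]
  · simp [h1]

theorem sum_keyIsometry (U : Fin k → Matrix.unitaryGroup (a × b) ℂ) :
    ∑ i, keyIsometry U i = twist U := by
  ext x s
  simp only [← keyProj_mul_twist, keyProj, Matrix.sum_apply, diagonal_mul]
  simp

theorem conjTranspose_twist_mul_self (U : Fin k → Matrix.unitaryGroup (a × b) ℂ) :
    (twist U)ᴴ * twist U = (k : ℂ) • 1 := by
  nth_rw 1 [← sum_keyIsometry]
  rw [conjTranspose_sum, Matrix.sum_mul]
  simp [conjTranspose_keyIsometry_mul_twist, Nat.cast_smul_eq_nsmul]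

theorem privateState_isState (hk : k ≠ 0) {ω : Matrix (a × b) (a × b) ℂ} (hω : IsState ω)
    (U : Fin k → Matrix.unitaryGroup (a × b) ℂ) : IsState (privateState k ω U) := by
  rw [privateState_eq]
  refine ⟨(hω.1.mul_mul_conjTranspose_same _).smul (by positivity), ?_⟩
  have hk' : (k : ℂ) ≠ 0 := by exact_mod_cast hk
  rw [trace_smul, Matrix.trace_mul_comm, ← Matrix.mul_assoc, conjTranspose_twist_mul_self,
    Matrix.smul_mul, Matrix.one_mul, trace_smul, hω.2]
  simp [hk']

/-- The operator `|i i⟩⟨j j| ⊗ U i * (U j)ᴴ`. -/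
def keyShift (U : Fin k → Matrix.unitaryGroup (a × b) ℂ) (i j : Fin k) :
    Matrix ((Fin k × a) × (Fin k × b)) ((Fin k × a) × (Fin k × b)) ℂ :=
  keyIsometry U i * (keyIsometry U j)ᴴ

theorem conjTranspose_keyShift_mul_self (U : Fin k → Matrix.unitaryGroup (a × b) ℂ)
    (i j : Fin k) : (keyShift U i j)ᴴ * keyShift U i j = keyShift U j j := by
  rw [keyShift, conjTranspose_mul, conjTranspose_conjTranspose, Matrix.mul_assoc,
    ← Matrix.mul_assoc (keyIsometry U i)ᴴ, conjTranspose_keyIsometry_mul_self, Matrix.one_mul,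
    keyShift]

/-- This is where privacy enters: on the state, projecting onto key value `i` amounts to moving the
key from `j` to `i` by a partial isometry on `AB`. Both sides reduce to `keyIsometry U i`, since
`(keyIsometry U j)ᴴ` is a left inverse of `twist U`. -/
theorem keyProj_mul_privateState (ω : Matrix (a × b) (a × b) ℂ)
    (U : Fin k → Matrix.unitaryGroup (a × b) ℂ) (i j : Fin k) :
    keyProj a b i * privateState k ω U = keyShift U i j * privateState k ω U := by
  rw [privateState_eq, Matrix.mul_smul, Matrix.mul_smul, Matrix.mul_assoc (twist U),
    ← Matrix.mul_assoc, keyProj_mul_twist, keyShift, Matrix.mul_assoc (keyIsometry U i),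
    ← Matrix.mul_assoc _ (twist U), conjTranspose_keyIsometry_mul_twist, Matrix.one_mul]

end PrivateState

/-! Flags. -/

section Flag

variable {a b : Type*}

theorem flagged_apply (i : Fin 2) (M : Matrix (a × b) (a × b) ℂ) (x y : (Fin 2 × a) × b) :
    flagged i M x y =
      if x.1.1 = i ∧ y.1.1 = i then M (x.1.2, x.2) (y.1.2, y.2) else 0 := by
  by_cases h1 : i = x.1.1 <;> by_cases h2 : i = y.1.1 <;>
    simp [flagged, Matrix.single_apply, h1, h2, eq_comm]

theorem conjTranspose_flagged (i : Fin 2) (M : Matrix (a × b) (a × b) ℂ) :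
    (flagged i M)ᴴ = flagged i Mᴴ := by
  simp [flagged, conjTranspose_submatrix, conjTranspose_kronecker]

variable [Fintype a] [Fintype b]

theorem flagged_mul_same (i : Fin 2) (M N : Matrix (a × b) (a × b) ℂ) :
    flagged i M * flagged i N = flagged i (M * N) := by
  simp [flagged, ← Matrix.mul_kronecker_mul]

theorem flagged_mul_of_ne {i j : Fin 2} (hij : i ≠ j) (M N : Matrix (a × b) (a × b) ℂ) :
    flagged i M * flagged j N = 0 := by
  simp [flagged, ← Matrix.mul_kronecker_mul, Matrix.single_mul_single_of_ne _ _ _ _ hij]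

end Flag

/-! ### Dominated extensions are incompatible with key. -/

theorem submatrix_traceLast_posSemidef_sub {x y : Type*} [Fintype y]
    {M : Matrix (x × y) (x × y) ℂ} (hM : M.PosSemidef) (j : y) :
    (traceLast M - M.submatrix (fun i => (i, j)) (fun i => (i, j))).PosSemidef := by
  classical
  rw [traceLast_eq_sum, ← Finset.add_sum_erase _ _ (Finset.mem_univ j), add_sub_cancel_left]
  exact posSemidef_sum _ fun j _ => hM.submatrix _

theorem le_traceMid_apply {a b : Type*} [Fintype b] {M : Matrix ((a × b) × b) ((a × b) × b) ℂ}
    (hM : M.PosSemidef) (x : a × b) (j : b) : M ((x.1, j), x.2) ((x.1, j), x.2) ≤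
      traceMid M x x :=
  Finset.single_le_sum (f := fun j => M ((x.1, j), x.2) ((x.1, j), x.2))
    (fun _ _ => hM.diag_nonneg) (Finset.mem_univ j)

/-- The key of a private state is independent of every extension, whereas in a dominated
extension the added system would know the key. -/
theorem HasDominatedExtension.eq_zero {a b : Type*} [Fintype a] [Fintype b] [DecidableEq a]
    [DecidableEq b] {k : ℕ} (hk : 2 ≤ k) {ω : Matrix (a × b) (a × b) ℂ} (hω : IsState ω)
    {U : Fin k → Matrix.unitaryGroup (a × b) ℂ} {q r : ℂ}
    {M : Matrix ((Fin k × a) × (Fin k × b)) ((Fin k × a) × (Fin k × b)) ℂ}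
    (h : HasDominatedExtension (q • flagged 1 (privateState k ω U) + r • flagged 0 M)) :
    q = 0 := by
  obtain ⟨τ, c, hτ, hR, hc⟩ := h
  set R := q • flagged 1 (privateState k ω U) + r • flagged 0 M with hRdef
  have hQR (i j : Fin k) :
      flagged 1 (keyProj a b i) * R = flagged 1 (keyShift U i j) * R := by
    simp [hRdef, Matrix.mul_add, flagged_mul_same, flagged_mul_of_ne,
      keyProj_mul_privateState ω U i j]
  -- The slice of `τ` at the basis state `e` of `E` lies below the marginal `R`. Hence, given `e`,
  -- Alice's key takes all values with equal weight.
  have htrace (i j : Fin k) (e : Fin k × b) :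
      (flagged 1 (keyProj a b i) * τ.submatrix (fun z => (z, e)) (fun z => (z, e))).trace =
        (flagged 1 (keyProj a b j) * τ.submatrix (fun z => (z, e)) (fun z => (z, e))).trace :=
    trace_mul_eq_of_posSemidef_sub (hτ.submatrix _)
      (hR ▸ submatrix_traceLast_posSemidef_sub hτ e)
      (by rw [conjTranspose_flagged, flagged_mul_same, conjTranspose_keyProj_mul_self])
      (by rw [conjTranspose_flagged, flagged_mul_same, conjTranspose_keyShift_mul_self])
      (hQR i j) (hQR j j)
  have htrace_eq (i : Fin k) (N : Matrix ((Fin 2 × (Fin k × a)) × (Fin k × b)) _ ℂ) :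
      (flagged 1 (keyProj a b i) * N).trace =
        ∑ x, if x.1.1 = 1 ∧ x.1.2.1 = i then N x x else 0 := by
    have hd : flagged 1 (keyProj a b i) =
        diagonal fun x => if x.1.1 = 1 ∧ x.1.2.1 = i then (1 : ℂ) else 0 := by
      ext x y
      rw [flagged_apply, keyProj]
      by_cases hxy : x = y
      · subst hxy
        by_cases h1 : x.1.1 = 1 <;> simp [h1]
      · rw [diagonal_apply_ne _ hxy]
        refine ite_eq_right_iff.2 fun h => diagonal_apply_ne _ fun h' => hxy ?_
        simp only [Prod.mk.injEq] at h'
        exact Prod.ext (Prod.ext (h.1.trans h.2.symm) h'.1) h'.2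
    rw [hd]
    simp [Matrix.trace, diagonal_mul]
  -- A private state has no weight on unequal key values. By domination, whatever the value of `c`,
  -- the marginal on `AE` has none either.
  have hagree (j : Fin k) (s : a) (y e : Fin k × b) (hj : j ≠ e.1) :
      τ (((1, (j, s)), y), e) (((1, (j, s)), y), e) = 0 := by
    have hR0 : R ((1, (j, s)), e) ((1, (j, s)), e) = 0 := by
      simp [hRdef, flagged_apply, privateState, hj]
    have h1 : traceMid τ ((1, (j, s)), e) ((1, (j, s)), e) ≤ 0 := by
      simpa [hR0] using hc.diag_nonneg (i := ((1, (j, s)), e))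
    exact le_antisymm ((le_traceMid_apply hτ ((1, (j, s)), e) y).trans h1) hτ.diag_nonneg
  have hzero (i : Fin k) (s : a) (y e : Fin k × b) :
      τ (((1, (i, s)), y), e) (((1, (i, s)), y), e) = 0 := by
    -- A key value `j` that disagrees with `e` has weight zero by `hagree`, and by `htrace` every
    -- other value `i` has the same weight.
    obtain ⟨j, hj⟩ : ∃ j : Fin k, j ≠ e.1 :=
      have : Nontrivial (Fin k) := Fin.nontrivial_iff_two_le.2 hk
      exists_ne e.1
    have h0 : (flagged 1 (keyProj a b j) *
        τ.submatrix (fun z => (z, e)) (fun z => (z, e))).trace = 0 := by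
      rw [htrace_eq]
      refine Finset.sum_eq_zero ?_
      rintro ⟨⟨f, j', s'⟩, y'⟩ -
      refine ite_eq_right_iff.2 ?_
      rintro ⟨rfl, rfl⟩
      exact hagree _ _ _ _ hj
    have h1 := (htrace i j e).trans h0
    rw [htrace_eq, Finset.sum_eq_zero_iff_of_nonneg] at h1
    · simpa using h1 ((1, (i, s)), y) (Finset.mem_univ _)
    · intro x _
      split_ifs
      · exact (hτ.submatrix _).diag_nonneg
      · exact le_rfl
  have hdiag (x : (Fin k × a) × (Fin k × b)) : q * privateState k ω U x x = 0 := by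
    have h1 : R ((1, x.1), x.2) ((1, x.1), x.2) = 0 := by
      rw [← hR]
      exact Finset.sum_eq_zero fun e _ => hzero _ _ _ _
    simpa [hRdef, flagged_apply] using h1
  have htr := (privateState_isState (by lia) hω U).2
  calc q = q * (privateState k ω U).trace := by rw [htr, mul_one]
    _ = 0 := by
      rw [Matrix.trace, Finset.mul_sum]
      exact Finset.sum_eq_zero fun x _ => hdiag x

theorem single_posSemidef {n : Type*} [DecidableEq n] (i : n) :
    (Matrix.single i i (1 : ℂ)).PosSemidef := by
  rw [← Matrix.diagonal_single]
  exact PosSemidef.diagonal (Pi.single_nonneg.2 zero_le_one)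

/-! Erased states. -/

section Erasure

variable {a b : Type*}

theorem embed_posSemidef [Fintype a] [Fintype b] {γ : Matrix (a × b) (a × b) ℂ}
    (hγ : γ.PosSemidef) : (embed γ).PosSemidef := by
  classical
  let W : Matrix (a × Option b) (a × b) ℂ := 
    Matrix.of fun x y => if (y.1, some y.2) = x then 1 else 0
  have h : embed γ = W * γ * Wᴴ := by
    ext ⟨i, _ | j⟩ ⟨i', _ | j'⟩ <;>
      simp [embed, W, Matrix.mul_apply, Fintype.sum_prod_type, ite_and, apply_ite (starRingEnd ℂ)]
  rw [h]
  exact hγ.mul_mul_conjTranspose_same W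

theorem traceLast_embed [Fintype b] (γ : Matrix (a × b) (a × b) ℂ) :
    traceLast (embed γ) = traceLast γ := by
  ext i i'
  simp [traceLast, embed, Fintype.sum_option]

theorem traceLast_kronecker [Fintype b] (M : Matrix a a ℂ) (N : Matrix b b ℂ) :
    traceLast (M ⊗ₖ N) = N.trace • M := by
  ext i i'
  simp [traceLast, Matrix.trace, ← Finset.mul_sum, mul_comm]

theorem traceMid_kronecker [Fintype b] (M : Matrix (a × b) (a × b) ℂ) (N : Matrix b b ℂ) :
    traceMid (M ⊗ₖ N) = traceLast M ⊗ₖ N := by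
  ext i i'
  simp [traceLast, traceMid, Finset.sum_mul]

theorem traceLast_swapBE [Fintype b] (M : Matrix ((a × b) × b) ((a × b) × b) ℂ) :
    traceLast (swapBE M) = traceMid M := rfl

theorem traceMid_swapBE [Fintype b] (M : Matrix ((a × b) × b) ((a × b) × b) ℂ) :
    traceMid (swapBE M) = traceLast M := rfl

theorem traceLast_add [Fintype b] (M N : Matrix (a × b) (a × b) ℂ) :
    traceLast (M + N) = traceLast M + traceLast N := by
  ext
  simp [traceLast, Finset.sum_add_distrib]

theorem traceLast_smul [Fintype b] (c : ℂ) (M : Matrix (a × b) (a × b) ℂ) :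
    traceLast (c • M) = c • traceLast M := by
  ext
  simp [traceLast, Finset.mul_sum]

theorem traceMid_add [Fintype b] (M N : Matrix ((a × b) × b) ((a × b) × b) ℂ) :
    traceMid (M + N) = traceMid M + traceMid N := by
  ext
  simp [traceMid, Finset.sum_add_distrib]

theorem traceMid_smul [Fintype b] (c : ℂ) (M : Matrix ((a × b) × b) ((a × b) × b) ℂ) :
    traceMid (c • M) = c • traceMid M := by
  ext
  simp [traceMid, Finset.mul_sum]

theorem isExtension_iff [Fintype a] [Fintype b] {τ : Matrix ((a × b) × b) ((a × b) × b) ℂ}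
    {ρ : Matrix (a × b) (a × b) ℂ} (hρ : ρ.trace = 1) :
    IsExtension τ ρ ↔ τ.PosSemidef ∧ traceLast τ = ρ :=
  ⟨fun h => ⟨h.1.1, h.2⟩, fun h => ⟨⟨h.1, by rw [← trace_traceLast, h.2, hρ]⟩, h.2⟩⟩

variable [DecidableEq b]

theorem erasure_posSemidef : (erasure b).PosSemidef := single_posSemidef none

variable [Fintype b]

theorem trace_erasure : (erasure b).trace = 1 := by
  simp [erasure]

theorem erased_zero (γ : Matrix (a × b) (a × b) ℂ) :
    erased 0 γ = traceLast γ ⊗ₖ erasure b := by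
  simp [erased]

theorem traceLast_erasedExtension (p : ℝ) (γ : Matrix (a × b) (a × b) ℂ) :
    traceLast (erasedExtension p γ) = erased p γ := by
  rw [erasedExtension, erased, traceLast_add, traceLast_smul, traceLast_smul, traceLast_swapBE,
    traceLast_kronecker, traceMid_kronecker, trace_erasure, one_smul, traceLast_embed]

theorem traceMid_erasedExtension (p : ℝ) (γ : Matrix (a × b) (a × b) ℂ) :
    traceMid (erasedExtension p γ) = erased (1 - p) γ := by
  rw [erasedExtension, erased, traceMid_add, traceMid_smul, traceMid_smul, traceMid_swapBE,
    traceLast_kronecker, traceMid_kronecker, trace_erasure, one_smul, traceLast_embed,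
    sub_sub_cancel, add_comm]

theorem supp_erased_one_sub_le [Fintype a] {p : ℝ} (hp0 : 0 < p) (hp1 : p < 1)
    (γ : Matrix (a × b) (a × b) ℂ) : supp (erased (1 - p) γ) ≤ supp (erased p γ) := by
  classical
  have hp : (p : ℂ) ≠ 0 := by exact_mod_cast hp0.ne'
  have hq : (1 - p : ℂ) ≠ 0 := by exact_mod_cast (sub_pos.2 hp1).ne'
  -- `d` holds the ratios of the weights of the two blocks; right multiplication cannot enlarge the
  -- range.
  let d : a × Option b → ℂ := fun x => if x.2 = none then p / (1 - p) else (1 - p) / p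
  have h : erased (1 - p) γ = erased p γ * diagonal d := by
    ext ⟨i, _ | j⟩ ⟨i', _ | j'⟩ <;> simp [erased, embed, erasure, d] <;> field_simp
  rw [h, supp, supp, Matrix.mulVecLin_mul]
  exact LinearMap.range_comp_le_range _ _

theorem supp_erased_one_sub [Fintype a] {p : ℝ} (hp0 : 0 < p) (hp1 : p < 1)
    (γ : Matrix (a × b) (a × b) ℂ) : supp (erased (1 - p) γ) = supp (erased p γ) := by
  refine le_antisymm (supp_erased_one_sub_le hp0 hp1 γ) ?_
  simpa using supp_erased_one_sub_le (sub_pos.2 hp1) (sub_lt_self 1 hp0) γ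

variable [Fintype a]

theorem traceLast_kronecker_erasure_posSemidef {γ : Matrix (a × b) (a × b) ℂ}
    (hγ : γ.PosSemidef) : (traceLast γ ⊗ₖ erasure b).PosSemidef :=
  (traceLast_posSemidef hγ).kronecker erasure_posSemidef

theorem erased_isState {p : ℝ} (hp0 : 0 ≤ p) (hp1 : p ≤ 1) {γ : Matrix (a × b) (a × b) ℂ}
    (hγ : IsState γ) : IsState (erased p γ) := by
  refine ⟨((embed_posSemidef hγ.1).smul (by exact_mod_cast hp0)).add
    ((traceLast_kronecker_erasure_posSemidef hγ.1).smul (by exact_mod_cast sub_nonneg.2 hp1)),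
    ?_⟩
  rw [erased, trace_add, trace_smul, trace_smul, trace_kronecker, trace_erasure,
    ← trace_traceLast (embed γ), traceLast_embed, trace_traceLast, hγ.2]
  simp

theorem erasedExtension_posSemidef {p : ℝ} (hp0 : 0 ≤ p) (hp1 : p ≤ 1)
    {γ : Matrix (a × b) (a × b) ℂ} (hγ : γ.PosSemidef) : (erasedExtension p γ).PosSemidef := by
  have h : (embed γ ⊗ₖ erasure b).PosSemidef := (embed_posSemidef hγ).kronecker erasure_posSemidef
  exact (h.smul (by exact_mod_cast hp0)).add
    ((h.submatrix _).smul (by exact_mod_cast sub_nonneg.2 hp1))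

theorem isExtension_erasedExtension {p : ℝ} (hp0 : 0 ≤ p) (hp1 : p ≤ 1)
    {γ : Matrix (a × b) (a × b) ℂ} (hγ : IsState γ) :
    IsExtension (erasedExtension p γ) (erased p γ) :=
  (isExtension_iff (erased_isState hp0 hp1 hγ).2).2
    ⟨erasedExtension_posSemidef hp0 hp1 hγ.1, traceLast_erasedExtension p γ⟩

/-- An erased share can be given to both parties. -/
theorem exists_isExtension_erased_zero {γ : Matrix (a × b) (a × b) ℂ} (hγ : IsState γ) :
    ∃ τ, IsExtension τ (erased 0 γ) ∧ traceMid τ = erased 0 γ := by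
  refine ⟨(traceLast γ ⊗ₖ erasure b) ⊗ₖ erasure b,
    (isExtension_iff (erased_isState le_rfl zero_le_one hγ).2).2
      ⟨(traceLast_kronecker_erasure_posSemidef hγ.1).kronecker erasure_posSemidef, ?_⟩, ?_⟩
  · rw [traceLast_kronecker, trace_erasure, one_smul, erased_zero]
  · rw [traceMid_kronecker, traceLast_kronecker, trace_erasure, one_smul, erased_zero]

theorem exists_isExtension_erased {p : ℝ} (hp0 : 0 ≤ p) (hp1 : p < 1)
    {γ : Matrix (a × b) (a × b) ℂ} (hγ : IsState γ) :
    ∃ τ, IsExtension τ (erased p γ) ∧ supp (traceMid τ) = supp (erased p γ) := by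
  -- At `p = 0` the other marginal of `erasedExtension` is `embed γ`, supported on the unerased
  -- block, so a different extension is needed.
  rcases hp0.eq_or_lt with rfl | hp
  · obtain ⟨τ, hτ, h⟩ := exists_isExtension_erased_zero hγ
    exact ⟨τ, hτ, by rw [h]⟩
  · exact ⟨_, isExtension_erasedExtension hp0 hp1.le hγ, by
      rw [traceMid_erasedExtension, supp_erased_one_sub hp hp1]⟩

theorem hasDominatedExtension_erased {p : ℝ} (hp0 : 0 ≤ p) (hp1 : p < 1)
    {γ : Matrix (a × b) (a × b) ℂ} (hγ : IsState γ) : HasDominatedExtension (erased p γ) := by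
  rcases hp0.eq_or_lt with rfl | hp
  · obtain ⟨τ, hτ, h⟩ := exists_isExtension_erased_zero hγ
    refine ⟨τ, 1, hτ.1.1, hτ.2, ?_⟩
    rw [h, one_smul, sub_self]
    exact PosSemidef.zero
  · have hq : 0 < 1 - p := sub_pos.2 hp1
    -- The two blocks require `c ≥ (1 - p) / p` and `c ≥ p / (1 - p)`; the sum of these bounds
    -- serves for both.
    refine ⟨erasedExtension p γ, (((1 - p) / p + p / (1 - p) : ℝ) : ℂ),
      erasedExtension_posSemidef hp0 hp1.le hγ.1, traceLast_erasedExtension p γ, ?_⟩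
    have h : (((1 - p) / p + p / (1 - p) : ℝ) : ℂ) • erased p γ -
        traceMid (erasedExtension p γ) = ((p * p / (1 - p) : ℝ) : ℂ) • embed γ +
          (((1 - p) * (1 - p) / p : ℝ) : ℂ) • (traceLast γ ⊗ₖ erasure b) := by
      have hpC : (p : ℂ) ≠ 0 := by exact_mod_cast hp.ne'
      have hqC : (1 - p : ℂ) ≠ 0 := by exact_mod_cast hq.ne'
      rw [traceMid_erasedExtension, erased, erased]
      push_cast
      match_scalars <;> field_simp <;> ring
    rw [h]
    exact ((embed_posSemidef hγ.1).smul (by exact_mod_cast (by positivity))).add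
      ((traceLast_kronecker_erasure_posSemidef hγ.1).smul (by exact_mod_cast (by positivity)))

end Erasure

/-! Distillable key. -/

theorem isCP_trace_smulRight {a a' : Type*} [Fintype a] [Fintype a'] {σ : Matrix a' a' ℂ}
    (hσ : σ.PosSemidef) : IsCP ((Matrix.traceLinearMap a ℂ ℂ).smulRight σ) :=
  fun _ _ hX => (traceLast_posSemidef hX).kronecker hσ

theorem isTP_trace_smulRight {a a' : Type*} [Fintype a] [Fintype a'] {σ : Matrix a' a' ℂ}
    (hσ : σ.trace = 1) : IsTP ((Matrix.traceLinearMap a ℂ ℂ).smulRight σ) := fun X => by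
  simp [hσ]

/-- This keeps the supremum in `oneShotKey` from falling below zero. The input is discarded and the
failure flag prepared, with all key and shield systems one-dimensional. -/
theorem distills_zero_one {a b : Type*} [Fintype a] [Fintype b] {ρ : Matrix (a × b) (a × b) ℂ}
    (hρ : ρ.trace = 1) : Distills ρ 0 1 := by
  let σA : Matrix (Fin 2 × (Fin 1 × Fin 1)) (Fin 2 × (Fin 1 × Fin 1)) ℂ :=
    Matrix.single (0, (0, 0)) (0, (0, 0)) 1
  let σB : Matrix (Fin 1 × Fin 1) (Fin 1 × Fin 1) ℂ := 1
  have hB : σB.trace = 1 := by simp [σB]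
  refine ⟨1, 1, 1, fun _ => 1, mapRight ((Matrix.traceLinearMap b ℂ ℂ).smulRight σB) ∘ₗ
    mapLeft ((Matrix.traceLinearMap a ℂ ℂ).smulRight σA), ⟨PosSemidef.one, by simp⟩,
    ⟨1, fun _ => (Matrix.traceLinearMap a ℂ ℂ).smulRight σA,
      fun _ => (Matrix.traceLinearMap b ℂ ℂ).smulRight σB,
      fun _ => isCP_trace_smulRight (single_posSemidef _), ?_,
      fun _ => ⟨isCP_trace_smulRight PosSemidef.one, isTP_trace_smulRight hB⟩, by simp⟩, ?_⟩
  · rw [Fin.sum_univ_one]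
    exact isTP_trace_smulRight (by simp [σA])
  · have h : mapRight ((Matrix.traceLinearMap b ℂ ℂ).smulRight σB)
        (mapLeft ((Matrix.traceLinearMap a ℂ ℂ).smulRight σA) ρ) = σA ⊗ₖ σB := by
      ext x y
      change (∑ j, (∑ i, ρ (i, j) (i, j)) * σA x.1 y.1) * σB x.2 y.2 = σA x.1 y.1 * σB x.2 y.2
      rw [← Finset.sum_mul, Finset.sum_comm, ← Fintype.sum_prod_type']
      change ρ.trace * _ * _ = _
      rw [hρ, one_mul]
    rw [LinearMap.comp_apply, h]
    ext ⟨⟨i, s⟩, y⟩ ⟨⟨i', s'⟩, y'⟩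
    rw [Subsingleton.elim s (0, 0), Subsingleton.elim s' (0, 0), Subsingleton.elim y y']
    fin_cases i <;> fin_cases i' <;> simp [σA, σB, flagged_apply, maxMixed]

theorem HasDominatedExtension.oneShotKey_eq_zero {a b : Type*} [Fintype a] [Fintype b]
    {ρ : Matrix (a × b) (a × b) ℂ} (h : HasDominatedExtension ρ) (hρ : ρ.trace = 1) :
    oneShotKey ρ = 0 := by
  refine le_antisymm (sSup_le ?_) (le_sSup ⟨0, 1, le_rfl, zero_le_one, le_rfl,
    distills_zero_one hρ, by simp⟩)
  rintro _ ⟨p, k, -, -, hk, ⟨m, n, ω, U, L, hω, hL, hLρ⟩, rfl⟩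
  rcases hk.eq_or_lt with rfl | hk
  · simp
  · have hp := (hLρ ▸ h.map hL).eq_zero hk hω
    rw [Complex.ofReal_eq_zero.1 hp]
    simp

theorem HasDominatedExtension.distillableKey_eq_zero {a b : Type*} [Fintype a] [Fintype b]
    {ρ : Matrix (a × b) (a × b) ℂ} (h : HasDominatedExtension ρ) (hρ : ρ.trace = 1) :
    distillableKey ρ = 0 := by
  -- This includes `n = 0`, where the quotient `0 / 0` is zero by convention.
  have h0 (n : ℕ) : oneShotKey (QKey.tensorPower ρ n) / (n : EReal) = 0 := by
    rw [(h.tensorPower n).oneShotKey_eq_zero (by rw [trace_tensorPower, hρ, one_pow]),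
      EReal.zero_div]
  simp [distillableKey, h0]

end QKey

theorem proposition2 {a b : Type*} [Fintype a] [Fintype b] [DecidableEq a] [DecidableEq b]
    (k : ℕ) (hk : 2 ≤ k) (ω : Matrix (a × b) (a × b) ℂ) (hω : QKey.IsState ω)
    (U : Fin k → Matrix.unitaryGroup (a × b) ℂ) (p : ℝ) (hp0 : 0 ≤ p) (hp1 : p < 1) :
    -- the erased private state is super two-extendible
    QKey.erased p (QKey.privateState k ω U) ∈
        QKey.superTwoExt (Fin k × a) (Option (Fin k × b)) ∧
    -- it has an extension whose other marginal has the same support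
    (∃ τ, QKey.IsExtension τ (QKey.erased p (QKey.privateState k ω U)) ∧
      QKey.supp (QKey.traceMid τ) = QKey.supp (QKey.erased p (QKey.privateState k ω U))) ∧
    -- the explicit extension, with its other marginal; for `p` in `(0, 1)` the supports agree
    (QKey.IsExtension (QKey.erasedExtension p (QKey.privateState k ω U))
        (QKey.erased p (QKey.privateState k ω U)) ∧
      QKey.traceMid (QKey.erasedExtension p (QKey.privateState k ω U)) =
        QKey.erased (1 - p) (QKey.privateState k ω U) ∧
      (0 < p → QKey.supp (QKey.erased (1 - p) (QKey.privateState k ω U)) =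
        QKey.supp (QKey.erased p (QKey.privateState k ω U)))) ∧
    -- the probabilistic one-way distillable secret key vanishes
    QKey.distillableKey (QKey.erased p (QKey.privateState k ω U)) = 0 := by
  have hγ := QKey.privateState_isState (by lia) hω U
  obtain ⟨τ, hτ, hsupp⟩ := QKey.exists_isExtension_erased hp0 hp1 hγ
  exact ⟨⟨QKey.erased_isState hp0 hp1.le hγ, _, ⟨τ, hτ, rfl⟩, hsupp.le⟩, ⟨τ, hτ, hsupp⟩,
    ⟨QKey.isExtension_erasedExtension hp0 hp1.le hγ, QKey.traceMid_erasedExtension p _,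
      fun hp => QKey.supp_erased_one_sub hp hp1 _⟩,
    (QKey.hasDominatedExtension_erased hp0 hp1 hγ).distillableKey_eq_zero
      (QKey.erased_isState hp0 hp1.le hγ).2⟩
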